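/- Let $n\ge 0$, let $G$ be a simple graph on the vertex set $\{0,1,\ldots,n\}$ with root $0$, let $\mathbb{K}$ be a field and let $R_n=\mathbb{K}[x_1,\ldots,x_n]$. For a nonempty set $S\subseteq\{1,\ldots,n\}$ and $i\in S$ let $d_S(i)$ be the number of edges of $G$ that join $i$ to a vertex outside $S$, and let $$\mathcal{M}_G^{(1)}=\Big\langle \prod_{i\in S}x_i^{d_S(i)} \;:\; \emptyset\ne S\subseteq\{1,\ldots,n\},\ |S|\le 2\Big\rangle\subseteq R_n$$ be the $1$-skeleton ideal of $G$. Let $\widetilde Q_G$ be the matrix obtained from the signless Laplace matrix $Q_G=D(G)+A(G)$ (degree matrix plus adjacency matrix) by deleting the row and the column of the vertex $0$. An essentially connected component of $G$ is an induced subgraph of $G$ on $V_1\cup\{0\}$, where $V_1$ is the vertex set of a connected component of the subgraph of $G$ induced on $\{1,\ldots,n\}$. (a) Suppose that $\mathcal{M}_G^{(1)}\neq R_n$ (equivalently, every connected component of $G$ that does not contain $0$ has at least three vertices; for example, $G$ is connected). Then $$\dim_{\mathbb{K}}\big(R_n/\mathcal{M}_G^{(1)}\big)=\det\widetilde Q_G$$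 if and only if each essentially connected component of $G$ is obtained from the complete simple graph on its vertex set by deleting some (possibly no) edges through the root $0$. (b) The "if" direction holds without the assumption $\mathcal{M}_G^{(1)}\neq R_n$: whenever each essentially connected component of $G$ is obtained from the complete simple graph on its vertex set by deleting some (possibly no) edges through the root $0$, the equality $\dim_{\mathbb{K}}(R_n/\mathcal{M}_G^{(1)})=\det\widetilde Q_G$ holds. -/

import Mathlib

namespace RootedGraph

section Matrices

/-- The signless Laplace matrix `Q_G = D(G) + A(G)`. -/
def signlessLapMatrix {V : Type*} [Fintype V] [DecidableEq V] (G : SimpleGraph V)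
    [DecidableRel G.Adj] : Matrix V V ℤ :=
  G.degMatrix ℤ + G.adjMatrix ℤ

/-- The truncated signless Laplace matrix: the row and the column of the root `r` are deleted. -/
def truncSignlessLapMatrix {V : Type*} [Fintype V] [DecidableEq V] (G : SimpleGraph V)
    [DecidableRel G.Adj] (r : V) : Matrix {v : V // v ≠ r} {v : V // v ≠ r} ℤ :=
  (signlessLapMatrix G).submatrix Subtype.val Subtype.val

end Matrices

section Ideals

/-- `d_S(i)`: the number of edges from `i` to vertices outside `S`. The root `r` is never in `S`,
as `S` is a set of non-root vertices, so an edge from `i` to the root is counted. -/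
def outDegree {V : Type*} [Fintype V] [DecidableEq V] (G : SimpleGraph V)
    [DecidableRel G.Adj] {r : V} (S : Finset {v : V // v ≠ r}) (i : {v : V // v ≠ r}) : ℕ :=
  (G.neighborFinset i.val \ S.map (Function.Embedding.subtype _)).card

/-- The monomial `m_S = ∏_{i ∈ S} x_i ^ d_S(i)`, in the polynomial ring with one variable for each
non-root vertex. -/
noncomputable def skeletonMonomial (K : Type*) [Field K] {V : Type*} [Fintype V] [DecidableEq V]
    (G : SimpleGraph V) [DecidableRel G.Adj] {r : V} (S : Finset {v : V // v ≠ r}) :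
    MvPolynomial {v : V // v ≠ r} K :=
  ∏ i ∈ S, MvPolynomial.X i ^ outDegree G S i

/-- The `k`-skeleton ideal, generated by the `m_S` over the nonempty sets `S` of at most `k + 1`
non-root vertices. -/
noncomputable def skeletonIdeal (K : Type*) [Field K] {V : Type*} [Fintype V] [DecidableEq V]
    (G : SimpleGraph V) [DecidableRel G.Adj] (r : V) (k : ℕ) :
    Ideal (MvPolynomial {v : V // v ≠ r} K) :=
  Ideal.span {m | ∃ S : Finset {v : V // v ≠ r},
    S.Nonempty ∧ S.card ≤ k + 1 ∧ m = skeletonMonomial K G S}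

/-- The quotient by a skeleton ideal is finite-dimensional, so `Module.finrank` is its honest
dimension. -/
theorem finite_quotient_skeletonIdeal (K : Type*) [Field K] {V : Type*} [Fintype V]
    [DecidableEq V] (G : SimpleGraph V) [DecidableRel G.Adj] (r : V) (k : ℕ) :
    Module.Finite K (MvPolynomial {v : V // v ≠ r} K ⧸ skeletonIdeal K G r k) := by
  set I := skeletonIdeal K G r k with hI
  have hnil : ∀ i : {v : V // v ≠ r},
      IsIntegral K (Ideal.Quotient.mkₐ K I (MvPolynomial.X i)) := by
    intro i
    have hmem : (MvPolynomial.X i ^ outDegree G {i} i : MvPolynomial {v : V // v ≠ r} K) ∈ I :=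
      Ideal.subset_span ⟨{i}, by simp, by simp, by simp [skeletonMonomial]⟩
    refine ⟨Polynomial.X ^ outDegree G {i} i, Polynomial.monic_X_pow _, ?_⟩
    rw [Polynomial.eval₂_pow, Polynomial.eval₂_X, ← map_pow]
    exact Ideal.Quotient.eq_zero_iff_mem.mpr hmem
  have hint : Algebra.IsIntegral K (MvPolynomial {v : V // v ≠ r} K ⧸ I) := by
    refine ⟨fun x => ?_⟩
    obtain ⟨p, rfl⟩ := Ideal.Quotient.mkₐ_surjective K I x
    induction p using MvPolynomial.induction_on with
    | C a => exact ((Ideal.Quotient.mkₐ K I).commutes a) ▸ isIntegral_algebraMap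
    | add p q hp hq => rw [map_add]; exact hp.add hq
    | mul_X p i hp => rw [map_mul]; exact hp.mul (hnil i)
  exact Algebra.IsIntegral.finite

end Ideals

section Components

/-- The subgraph induced on the non-root vertices. -/
abbrev deleteRoot {V : Type*} (G : SimpleGraph V) (r : V) : SimpleGraph {v : V // v ≠ r} :=
  G.induce {v : V | v ≠ r}

/-- The vertex set `V₁ ∪ {r}` of the essentially connected component that belongs to a connected
component, with vertex set `V₁`, of the subgraph induced on the non-root vertices. -/
def essVertices {V : Type*} (G : SimpleGraph V) (r : V)
    (c : (deleteRoot G r).ConnectedComponent) : Set V :=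
  insert r (Subtype.val '' c.supp)

/-- The essentially connected component: the subgraph of `G` induced on `V₁ ∪ {r}`. -/
abbrev essComponent {V : Type*} (G : SimpleGraph V) (r : V)
    (c : (deleteRoot G r).ConnectedComponent) : SimpleGraph (essVertices G r c) :=
  G.induce (essVertices G r c)

/-- The root as a vertex of an essentially connected component. -/
def essRoot {V : Type*} (G : SimpleGraph V) (r : V)
    (c : (deleteRoot G r).ConnectedComponent) : essVertices G r c :=
  ⟨r, Set.mem_insert _ _⟩

/-- `G` is obtained from the complete simple graph on its vertex set by deleting a (possibly empty)
set of edges through the root `r`. -/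
def IsCompleteMinusRootEdges {V : Type*} (G : SimpleGraph V) (r : V) : Prop :=
  ∃ E : Set (Sym2 V), E ⊆ (⊤ : SimpleGraph V).incidenceSet r ∧
    G = (⊤ : SimpleGraph V).deleteEdges E

end Components

end RootedGraph

/-! Let `H` be `G` without the root and `d i` the degree of `i` in `G`. If some `d i = 0`, the ideal
is everything and a row of the matrix vanishes, so both sides are `0`. Otherwise the standard
monomials are the exponents `a` with `a i < d i` whose set `I` of maximal entries `a i = d i - 1` is
independent in `H`; sorting them by `I` gives `indepSum`. Splitting by whether `v ∈ I` yields the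
recursion f(s + v) = (d v - 1) f(s) + (∏ over neighbours u of v in s of (d u - 1)) · f(s minus the
neighbours of v).

The principal minors of diag(d) + A(H) nearly satisfy it. Lowering the entry at `v` to `1` splits
off (d v - 1) det(s); eliminating `v` by a congruence (`exists_eliminated`) then leaves diagonal
entries `d u - 1` at the neighbours of `v` and does not change the block of non-neighbours.
Fischer's inequality bounds the remaining determinant by the second term of the recursion, so the
determinant is at most the dimension.

After elimination the entry at `(u, w)`, for a neighbour `u` of `v`, is A(u, w) - A(v, w). If
adjacency in `H` is transitive on distinct vertices, these all vanish and equality holds. An induced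
path on three vertices makes one of them nonzero and Fischer strict, once the eliminated vertex is
chosen so that the second term of the recursion is positive. -/

namespace Matrix

/-! ### Principal minors as determinants of full-size matrices. -/

section Pin

variable {V R : Type*} [DecidableEq V] [CommRing R]

/-- The matrix obtained from `P` by replacing the rows and columns in `T` by those of the identity;
its determinant is the principal minor of `P` on the complement of `T`. -/
def pin (P : Matrix V V R) (T : Finset V) : Matrix V V R :=
  of fun i j => if i ∈ T ∨ j ∈ T then (1 : Matrix V V R) i j else P i j

theorem pin_apply (P : Matrix V V R) (T : Finset V) (i j : V) :
    pin P T i j = if i ∈ T ∨ j ∈ T then (1 : Matrix V V R) i j else P i j := rfl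

@[simp] theorem pin_empty (P : Matrix V V R) : pin P ∅ = P := by
  ext i j; simp [pin_apply]

theorem pin_pin (P : Matrix V V R) (S T : Finset V) : pin (pin P S) T = pin P (S ∪ T) := by
  ext i j
  simp only [pin_apply, Finset.mem_union]
  grind

theorem det_pin_singleton [Fintype V] (P : Matrix V V R) (u : V) :
    (pin P {u}).det = (toSquareBlockProp P (· ≠ u)).det := by
  rw [twoBlockTriangular_det (pin P {u}) (· ≠ u)
    (fun i hi j hj => by simp_all [pin_apply, eq_comm])]
  have h1 : (toSquareBlockProp (pin P {u}) (fun i => ¬ (i ≠ u))).det = 1 := by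
    have : toSquareBlockProp (pin P {u}) (fun i => ¬ (i ≠ u)) = 1 := by
      ext ⟨i, hi⟩ ⟨j, hj⟩
      simp only [not_not] at hi hj
      subst hi; subst hj
      simp [toSquareBlockProp_def, pin_apply]
    rw [this, det_one]
  rw [h1, mul_one]
  congr 1
  ext ⟨i, hi⟩ ⟨j, hj⟩
  simp [toSquareBlockProp_def, pin_apply, hi, hj]

theorem det_eq_mul_det_pin_of_row [Fintype V] {P : Matrix V V R} {u : V}
    (h : ∀ j, j ≠ u → P u j = 0) : P.det = P u u * (pin P {u}).det := by
  rw [det_pin_singleton, twoBlockTriangular_det P (· ≠ u)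
    (fun i hi j hj => by simp only [not_not] at hi; subst hi; exact h j hj), mul_comm]
  congr 1
  have : Subsingleton {a // ¬ (a ≠ u)} :=
    ⟨fun a b => Subtype.ext ((not_not.mp a.2).trans (not_not.mp b.2).symm)⟩
  rw [det_eq_elem_of_subsingleton _ ⟨u, by simp⟩]
  rfl

theorem det_eq_prod_mul_det_pin [Fintype V] {P : Matrix V V R} {T : Finset V}
    (h : ∀ u ∈ T, ∀ j, j ≠ u → P u j = 0) : P.det = (∏ u ∈ T, P u u) * (pin P T).det := by
  induction T using Finset.induction_on with
  | empty => simp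
  | insert u T hu ih =>
    rw [ih (fun w hw => h w (Finset.mem_insert_of_mem hw)),
      det_eq_mul_det_pin_of_row (P := pin P T) (u := u), pin_pin, Finset.prod_insert hu,
      Finset.union_comm, ← Finset.insert_eq]
    · simp [pin_apply, hu]; ring
    · intro j hj
      rw [pin_apply]
      split_ifs
      · exact one_apply_ne hj.symm
      · exact h u (Finset.mem_insert_self _ _) j hj

/-- Expansion of the determinant in a diagonal entry. -/
theorem det_eq_sub_mul_det_pin_add [Fintype V] {P Q : Matrix V V R} {u : V}
    (h : ∀ i j, (i ≠ u ∨ j ≠ u) → P i j = Q i j) :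
    P.det = (P u u - Q u u) * (pin P {u}).det + Q.det := by
  have h1 : P = updateRow Q u ((P u u - Q u u) • Pi.single u 1 + Q u) := by
    ext i j
    by_cases hi : i = u
    · subst hi
      by_cases hj : j = i
      · subst hj; simp
      · simp [hj, h i j (Or.inr hj)]
    · simp [updateRow_ne hi, h i j (Or.inl hi)]
  have h2 : (updateRow Q u (Pi.single u 1)).det = (pin P {u}).det := by
    rw [det_eq_mul_det_pin_of_row (u := u) (fun j hj => by simp [hj])]
    simp only [updateRow_self, Pi.single_eq_same, one_mul]
    congr 1
    ext i j
    simp only [pin_apply, Finset.mem_singleton]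
    split_ifs with hij
    · rfl
    · push Not at hij
      rw [updateRow_ne hij.1, h i j (Or.inl hij.1)]
  conv_lhs => rw [h1]
  rw [det_updateRow_add, det_updateRow_smul, h2, updateRow_eq_self]

end Pin

/-! ### Schur complements, Fischer's inequality and diagonal dominance over the reals. -/

section Real

variable {V : Type*} [Fintype V] [DecidableEq V]

theorem pin_eq_mul_add {R : Type*} [CommRing R] (P : Matrix V V R) (T : Finset V) :
    pin P T = diagonal (fun i => if i ∈ T then 0 else 1) * P *
      diagonal (fun i => if i ∈ T then 0 else 1) + diagonal (fun i => if i ∈ T then 1 else 0) := by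
  ext i j
  simp only [pin_apply, add_apply, mul_diagonal, diagonal_mul, one_apply, diagonal_apply]
  grind

/-- The quadratic form at `x` is that of `P` at `x` with its `T`-coordinates set to zero, plus the
sum of squares of the `T`-coordinates; these two terms cannot both vanish for `x ≠ 0`. -/
theorem PosDef.pin {P : Matrix V V ℝ} (hP : P.PosDef) (T : Finset V) : (pin P T).PosDef := by
  have h1 := hP.posSemidef.mul_mul_conjTranspose_same
    (diagonal (fun i => if i ∈ T then (0 : ℝ) else 1))
  have h2 : (diagonal (fun i => if i ∈ T then (1 : ℝ) else 0)).PosSemidef :=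
    posSemidef_diagonal_iff.mpr fun i => by split_ifs <;> norm_num
  have e : (diagonal (fun i => if i ∈ T then (0 : ℝ) else 1))ᴴ =
      diagonal (fun i => if i ∈ T then (0 : ℝ) else 1) := by
    simp
  rw [e] at h1
  have h3 := h1.add h2
  rw [← pin_eq_mul_add] at h3
  refine PosDef.of_dotProduct_mulVec_pos h3.isHermitian fun x hx => ?_
  set E := diagonal (fun i => if i ∈ T then (0 : ℝ) else 1) with hE
  have key : star x ⬝ᵥ (Matrix.pin P T *ᵥ x) =
      star (E *ᵥ x) ⬝ᵥ (P *ᵥ (E *ᵥ x)) + ∑ i, if i ∈ T then x i ^ 2 else 0 := by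
    rw [pin_eq_mul_add, ← hE, add_mulVec, dotProduct_add]
    congr 1
    · rw [star_mulVec, e, ← dotProduct_mulVec, mulVec_mulVec, mulVec_mulVec, Matrix.mul_assoc]
    · simp [dotProduct, mulVec_diagonal, pow_two]
  rw [key]
  have hsum : 0 ≤ ∑ i, if i ∈ T then x i ^ 2 else 0 :=
    Finset.sum_nonneg fun i _ => by split_ifs <;> positivity
  by_cases hEx : E *ᵥ x = 0
  · rw [hEx]
    simp only [star_zero, zero_dotProduct, zero_add]
    obtain ⟨i, hi⟩ := Function.ne_iff.mp hx
    have hiT : i ∈ T := by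
      by_contra hiT
      have := congrFun hEx i
      simp [hE, mulVec_diagonal, hiT] at this
      exact hi this
    refine lt_of_lt_of_le (b := x i ^ 2) (by have : x i ≠ 0 := hi; positivity) ?_
    have := Finset.single_le_sum (f := fun i => if i ∈ T then x i ^ 2 else 0)
      (fun i _ => by split_ifs <;> positivity) (Finset.mem_univ i)
    simpa [hiT] using this
  · exact add_pos_of_pos_of_nonneg (hP.dotProduct_mulVec_pos hEx) hsum

/-- The Schur complement of a positive definite principal submatrix of corank one. -/
theorem IsHermitian.exists_det_eq_sub_mul_det_pin {P : Matrix V V ℝ} (hP : P.IsHermitian) {u : V}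
    (hD : (pin P {u}).PosDef) :
    ∃ q : ℝ, 0 ≤ q ∧ P.det = (P u u - q) * (pin P {u}).det ∧
      ((∃ j, j ≠ u ∧ P u j ≠ 0) → 0 < q) ∧ (0 ≤ P u u - q → P.PosSemidef) := by
  set D := toBlock P (fun i => i ≠ u) (fun i => i ≠ u) with hDdef
  have hD' : D.PosDef := by
    have := hD.submatrix (e := (Subtype.val : {i // i ≠ u} → V)) Subtype.val_injective
    convert this using 1
    ext ⟨i, hi⟩ ⟨j, hj⟩
    simp [hDdef, toBlock_apply, pin_apply, hi, hj]
  have hdetD : (pin P {u}).det = D.det := det_pin_singleton P u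
  set A := toBlock P (fun i => ¬ i ≠ u) (fun i => ¬ i ≠ u) with hA
  set B := toBlock P (fun i => i ≠ u) (fun i => ¬ i ≠ u) with hB
  have hC : toBlock P (fun i => ¬ i ≠ u) (fun i => i ≠ u) = Bᴴ := by
    ext ⟨i, hi⟩ ⟨j, hj⟩
    simp only [toBlock_apply, conjTranspose_apply, hB]
    exact (hP.apply i j).symm
  let w : {i // ¬ i ≠ u} := ⟨u, by simp⟩
  have hw : ∀ a : {i // ¬ i ≠ u}, a = w := fun a => Subtype.ext (not_not.mp a.2)
  have : Subsingleton {i // ¬ i ≠ u} := ⟨fun a b => (hw a).trans (hw b).symm⟩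
  let _ : Invertible D := hD'.isUnit.invertible
  have hBw : (Bᴴ * D⁻¹ * B) w w = star (Bᵀ w) ⬝ᵥ (D⁻¹ *ᵥ (Bᵀ w)) := by
    rw [dotProduct_mulVec]
    simp [mul_apply, dotProduct, vecMul]
  refine ⟨(Bᴴ * D⁻¹ * B) w w, ?_, ?_, ?_, ?_⟩
  · exact (hD'.inv.posSemidef.conjTranspose_mul_mul_same B).diag_nonneg
  · rw [det_toBlock P (fun i => i ≠ u), hC, ← hA, ← hB, ← hDdef, det_fromBlocks₁₁, hdetD,
      det_eq_elem_of_subsingleton _ w, invOf_eq_nonsing_inv, mul_comm]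
    rfl
  · rintro ⟨j, hj, hne⟩
    rw [hBw]
    refine hD'.inv.dotProduct_mulVec_pos fun h0 => hne ?_
    have := congrFun h0 ⟨j, hj⟩
    rw [← hP.apply]
    simpa [hB, toBlock_apply, w] using this
  · intro h
    have h1 : (Matrix.fromBlocks D B Bᴴ A).PosSemidef := by
      rw [PosDef.fromBlocks₁₁ B A hD']
      have : A - Bᴴ * D⁻¹ * B = diagonal (fun _ => P u u - (Bᴴ * D⁻¹ * B) w w) := by
        ext a b
        rw [hw a, hw b, diagonal_apply_eq]
        rfl
      rw [this]
      exact posSemidef_diagonal_iff.mpr fun _ => h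
    have h2 := h1.submatrix (Equiv.sumCompl (fun i => i ≠ u)).symm
    convert h2 using 1
    rw [← hC]
    ext i j
    obtain ⟨i, rfl⟩ := (Equiv.sumCompl (fun i => i ≠ u)).surjective i
    obtain ⟨j, rfl⟩ := (Equiv.sumCompl (fun i => i ≠ u)).surjective j
    rw [submatrix_apply, Equiv.symm_apply_apply, Equiv.symm_apply_apply]
    rcases i with i | i <;> rcases j with j | j <;> rfl

theorem IsHermitian.posDef_of_pin {P : Matrix V V ℝ} (hP : P.IsHermitian) {u : V}
    (hD : (pin P {u}).PosDef) (h : 0 < P.det) : P.PosDef := by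
  obtain ⟨q, -, h1, -, h2⟩ := hP.exists_det_eq_sub_mul_det_pin hD
  have h3 : 0 < P u u - q := by
    rw [h1] at h
    exact pos_of_mul_pos_left h hD.det_pos.le
  exact (h2 h3.le).posDef_iff_det_ne_zero.mpr h.ne'

theorem IsHermitian.det_le_of_pin_posDef {P : Matrix V V ℝ} (hP : P.IsHermitian) {u : V}
    (hD : (pin P {u}).PosDef) : P.det ≤ P u u * (pin P {u}).det := by
  obtain ⟨q, h0, h1, -⟩ := hP.exists_det_eq_sub_mul_det_pin hD
  rw [h1]
  exact mul_le_mul_of_nonneg_right (by linarith) hD.det_pos.le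

theorem IsHermitian.det_lt_of_pin_posDef {P : Matrix V V ℝ} (hP : P.IsHermitian) {u : V}
    (hD : (pin P {u}).PosDef) (h : ∃ j, j ≠ u ∧ P u j ≠ 0) :
    P.det < P u u * (pin P {u}).det := by
  obtain ⟨q, -, h1, h2, -⟩ := hP.exists_det_eq_sub_mul_det_pin hD
  have := h2 h
  rw [h1]
  exact mul_lt_mul_of_pos_right (by linarith) hD.det_pos

/-- Perturb by `ε • 1` to reach the positive definite case and let `ε` tend to `0` from above.
Diagonally dominant matrices can be singular, so this boundary case is needed. -/
theorem IsHermitian.det_le_of_pin_posSemidef {P : Matrix V V ℝ} (hP : P.IsHermitian) {u : V}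
    (hD : (pin P {u}).PosSemidef) : P.det ≤ P u u * (pin P {u}).det := by
  have h1 : ∀ ε : ℝ, 0 < ε → (P + ε • (1 : Matrix V V ℝ)).det ≤
      (P + ε • (1 : Matrix V V ℝ)) u u * (pin (P + ε • (1 : Matrix V V ℝ)) {u}).det := by
    intro ε hε
    have hI : (ε • (1 : Matrix V V ℝ)).PosDef := PosDef.one.smul hε
    refine (hP.add hI.isHermitian).det_le_of_pin_posDef ?_
    convert (PosDef.posSemidef_add hD hI).pin {u} using 1
    ext i j
    simp only [pin_apply, add_apply]
    grind
  have hc : Continuous fun ε : ℝ => P + ε • (1 : Matrix V V ℝ) := by fun_prop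
  have hcp : Continuous fun ε : ℝ => pin (P + ε • (1 : Matrix V V ℝ)) {u} := by
    refine continuous_matrix fun i j => ?_
    simp only [pin_apply]
    split_ifs
    · exact continuous_const
    · exact hc.matrix_elem i j
  have hl := (hc.matrix_det.tendsto 0).mono_left (nhdsWithin_le_nhds (s := Set.Ioi (0 : ℝ)))
  have hr := (((hc.matrix_elem u u).mul hcp.matrix_det).tendsto 0).mono_left
    (nhdsWithin_le_nhds (s := Set.Ioi (0 : ℝ)))
  have := le_of_tendsto_of_tendsto hl hr
    (Filter.eventually_of_mem self_mem_nhdsWithin fun ε hε => h1 ε hε)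
  simpa using this

/-- Fischer's inequality with diagonal blocks of size one split off. -/
theorem PosDef.det_le_prod_mul_det_pin {P : Matrix V V ℝ} (hP : P.PosDef) (T : Finset V) :
    P.det ≤ (∏ u ∈ T, P u u) * (Matrix.pin P T).det := by
  induction T using Finset.induction_on with
  | empty => simp
  | insert u T hu ih =>
    refine ih.trans ?_
    have h1 := (hP.pin T).isHermitian.det_le_of_pin_posDef ((hP.pin T).pin {u})
    rw [pin_pin, Finset.union_comm, ← Finset.insert_eq] at h1
    have h2 : Matrix.pin P T u u = P u u := by simp [pin_apply, hu]
    rw [h2] at h1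
    rw [Finset.prod_insert hu, mul_comm (P u u), mul_assoc]
    exact mul_le_mul_of_nonneg_left h1 (Finset.prod_nonneg fun i _ => hP.diag_pos.le)

/-- Splitting off `u` first loses a strictly positive amount, because its row has a nonzero
off-diagonal entry; the rest of `T` follows by the weak inequality. -/
theorem PosDef.det_lt_prod_mul_det_pin {P : Matrix V V ℝ} (hP : P.PosDef) {T : Finset V} {u j : V}
    (hu : u ∈ T) (hj : j ≠ u) (h : P u j ≠ 0) :
    P.det < (∏ u ∈ T, P u u) * (Matrix.pin P T).det := by
  have h1 := hP.isHermitian.det_lt_of_pin_posDef (hP.pin {u}) ⟨j, hj, h⟩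
  have h2 := (hP.pin {u}).det_le_prod_mul_det_pin (T.erase u)
  rw [pin_pin, ← Finset.insert_eq, Finset.insert_erase hu] at h2
  have h3 : ∏ w ∈ T.erase u, Matrix.pin P {u} w w = ∏ w ∈ T.erase u, P w w :=
    Finset.prod_congr rfl fun w hw => by simp [pin_apply, Finset.ne_of_mem_erase hw]
  rw [← Finset.mul_prod_erase T _ hu, mul_assoc]
  rw [h3] at h2
  exact h1.trans_le (mul_le_mul_of_nonneg_left h2 hP.diag_pos.le)

/-- Adding multiples of the row and of the column of `v` to the others is a congruence. -/
theorem exists_congruence_eq {P : Matrix V V ℝ} {v : V} {c : V → ℝ} (hc : c v = 0) :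
    ∃ Q : Matrix V V ℝ,
      (∀ i j, Q i j = P i j + c i * P v j + c j * P i v + c i * c j * P v v) ∧
      Q.det = P.det ∧ (P.PosSemidef → Q.PosSemidef) := by
  set L : Matrix V V ℝ := 1 + vecMulVec c (Pi.single v 1) with hL
  have hdet : L.det = 1 := by
    rw [det_eq_of_forall_row_eq_smul_add_const (B := 1) c v hc, det_one]
    intro i j
    simp [hL, vecMulVec_apply, Pi.single_apply, one_apply, eq_comm]
  refine ⟨L * P * Lᴴ, fun i j => ?_, ?_, fun h => h.mul_mul_conjTranspose_same L⟩
  · have h1 : ∀ i j, (L * P) i j = P i j + c i * P v j := by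
      intro i j
      simp [hL, add_mul, mul_apply, vecMulVec_apply, Pi.single_apply, one_apply,
        Finset.sum_add_distrib]
    have h2 : ∀ (A : Matrix V V ℝ) i j, (A * Lᴴ) i j = A i j + c j * A i v := by
      intro A i j
      simp [hL, mul_add, mul_apply, vecMulVec_apply, Pi.single_apply, mul_comm, one_apply,
        Finset.sum_add_distrib]
    rw [h2, h1, h1]
    ring
  · rw [det_mul, det_mul, det_conjTranspose, hdet]
    simp

/-- A diagonally dominant symmetric real matrix is positive semidefinite. -/
theorem IsHermitian.posSemidef_of_sum_abs_le_diag {P : Matrix V V ℝ} (hP : P.IsHermitian)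
    (h : ∀ i, ∑ j ∈ Finset.univ.erase i, |P i j| ≤ P i i) : P.PosSemidef := by
  refine PosSemidef.of_dotProduct_mulVec_nonneg hP fun x => ?_
  have hsymm : ∀ i j, P i j = P j i := fun i j => by simpa using (hP.apply i j).symm
  have e : star x ⬝ᵥ (P *ᵥ x) = ∑ i, ∑ j, P i j * x i * x j := by
    simp only [dotProduct, mulVec, Pi.star_apply, star_trivial, Finset.mul_sum]
    exact Finset.sum_congr rfl fun i _ => Finset.sum_congr rfl fun j _ => by ring
  rw [e]
  -- Off the diagonal this is |xy| ≤ x²/2 + y²/2, with the loss shared between rows `i` and `j` so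
  -- that dominance can be applied row by row.
  have h1 : ∀ i j, (if i = j then P i i * x i ^ 2 else
      -(|P i j| * x i ^ 2 / 2 + |P j i| * x j ^ 2 / 2)) ≤ P i j * x i * x j := by
    intro i j
    split_ifs with hij
    · subst hij; exact le_of_eq (by ring)
    · rw [hsymm j i]
      have h2 : -(P i j * (x i * x j)) ≤ |P i j| * |x i * x j| := by
        rw [← abs_mul]; exact neg_le_abs _
      have h3 : |x i * x j| ≤ x i ^ 2 / 2 + x j ^ 2 / 2 := by
        rw [abs_le]; constructor <;> nlinarith [sq_nonneg (x i + x j), sq_nonneg (x i - x j)]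
      nlinarith [mul_le_mul_of_nonneg_left h3 (abs_nonneg (P i j))]
  refine le_trans ?_ (Finset.sum_le_sum fun i _ => Finset.sum_le_sum fun j _ => h1 i j)
  have h2 : ∀ i j, (if i = j then P i i * x i ^ 2 else
      -(|P i j| * x i ^ 2 / 2 + |P j i| * x j ^ 2 / 2)) =
      (if i = j then P i i * x i ^ 2 / 2 else -(|P i j| * x i ^ 2 / 2)) +
      (if j = i then P j j * x j ^ 2 / 2 else -(|P j i| * x j ^ 2 / 2)) := by
    intro i j
    by_cases hij : i = j
    · subst hij; simp
    · simp only [hij, Ne.symm hij, if_false]; ring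
  have h3 : 0 ≤ ∑ i, ∑ j, (if i = j then P i i * x i ^ 2 / 2 else -(|P i j| * x i ^ 2 / 2)) := by
    refine Finset.sum_nonneg fun i _ => ?_
    rw [← Finset.add_sum_erase _ _ (Finset.mem_univ i), if_pos rfl,
      Finset.sum_congr rfl fun j hj => if_neg (Finset.ne_of_mem_erase hj).symm,
      Finset.sum_neg_distrib, ← Finset.sum_div, ← Finset.sum_mul]
    have := mul_le_mul_of_nonneg_right (h i) (sq_nonneg (x i))
    linarith
  simp only [h2, Finset.sum_add_distrib]
  rw [Finset.sum_comm (f := fun i j => if j = i then P j j * x j ^ 2 / 2 else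
    -(|P j i| * x j ^ 2 / 2))]
  exact add_nonneg h3 h3

end Real

end Matrix

namespace RootedGraph

open Matrix

/-! ### The vertex recursion for the weighted count of independent sets. -/

section Counting

variable {V : Type*} [DecidableEq V] (H : SimpleGraph V) [DecidableRel H.Adj] (d : V → ℝ)

/-- The sum of `∏ (d i - 1)`, over the complements in `s` of the independent subsets of `s`. -/
def indepSum (s : Finset V) : ℝ :=
  ∑ I ∈ s.powerset, if ∀ i ∈ I, ∀ j ∈ I, ¬ H.Adj i j then ∏ i ∈ s \ I, (d i - 1) else 0

/-- Split by whether `v ∈ I`. If it is, no neighbour of `v` lies in `I`, so all of them contribute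
their factors `d u - 1`. -/
theorem indepSum_insert {v : V} {s : Finset V} (hv : v ∉ s) :
    indepSum H d (insert v s) = (d v - 1) * indepSum H d s +
      (∏ u ∈ s with H.Adj v u, (d u - 1)) * indepSum H d {u ∈ s | ¬ H.Adj v u} := by
  unfold indepSum
  rw [Finset.sum_powerset_insert hv]
  congr 1
  · rw [Finset.mul_sum]
    refine Finset.sum_congr rfl fun I hI => ?_
    rw [Finset.mem_powerset] at hI
    split_ifs
    · rw [Finset.insert_sdiff_of_notMem _ (fun h => hv (hI h)),
        Finset.prod_insert (fun h => hv (Finset.mem_sdiff.mp h).1)]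
    · simp
  · rw [Finset.mul_sum]
    symm
    refine Eq.trans ?_ (Finset.sum_subset
      (Finset.powerset_mono.mpr (Finset.filter_subset (fun u => ¬ H.Adj v u) s)) ?_)
    · refine Finset.sum_congr rfl fun I hI => ?_
      rw [Finset.mem_powerset] at hI
      have hIs : ∀ i ∈ I, i ∈ s ∧ ¬ H.Adj v i := fun i hi => Finset.mem_filter.mp (hI hi)
      have hiff : (∀ i ∈ insert v I, ∀ j ∈ insert v I, ¬ H.Adj i j) ↔
          ∀ i ∈ I, ∀ j ∈ I, ¬ H.Adj i j := by
        refine ⟨fun h i hi j hj => h i (Finset.mem_insert_of_mem hi) j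
          (Finset.mem_insert_of_mem hj), fun h i hi j hj => ?_⟩
        rcases Finset.mem_insert.mp hi with e | hi' <;>
          rcases Finset.mem_insert.mp hj with e' | hj'
        · rw [e, e']; exact H.loopless.irrefl _
        · rw [e]; exact (hIs j hj').2
        · rw [e']; exact fun hadj => (hIs i hi').2 hadj.symm
        · exact h i hi' j hj'
      rw [if_congr hiff rfl rfl, mul_ite, mul_zero]
      congr 1
      rw [← Finset.prod_union]
      · refine Finset.prod_congr ?_ fun _ _ => rfl
        ext i
        have := hIs i
        simp only [Finset.mem_union, Finset.mem_filter, Finset.mem_sdiff, Finset.mem_insert]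
        grind
      · rw [Finset.disjoint_left]
        intro i
        simp only [Finset.mem_filter, Finset.mem_sdiff]
        tauto
    · intro I hI hI'
      rw [Finset.mem_powerset] at hI hI'
      rw [if_neg]
      intro h
      refine hI' fun i hi => Finset.mem_filter.mpr ⟨hI hi, ?_⟩
      exact h v (Finset.mem_insert_self _ _) i (Finset.mem_insert_of_mem hi)

variable {H d}

/-- An independent `I` with a nonzero term for `t` restricts to `I ∩ s`, whose product for `s` runs
over a subset of the same nonzero factors. -/
theorem indepSum_pos_of_subset (hd : ∀ i, 1 ≤ d i) {s t : Finset V} (hst : s ⊆ t)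
    (h : 0 < indepSum H d t) : 0 < indepSum H d s := by
  have hp : ∀ u : Finset V, 0 ≤ ∏ i ∈ u, (d i - 1) := fun u =>
    Finset.prod_nonneg fun i _ => sub_nonneg.mpr (hd i)
  obtain ⟨I, hI, hne⟩ := Finset.exists_ne_zero_of_sum_ne_zero h.ne'
  have hind : ∀ i ∈ I, ∀ j ∈ I, ¬ H.Adj i j := by
    by_contra hc
    exact hne (if_neg hc)
  rw [if_pos hind, Finset.prod_ne_zero_iff] at hne
  refine Finset.sum_pos' (fun J _ => ?_) ⟨I ∩ s, ?_, ?_⟩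
  · split_ifs
    · exact hp _
    · exact le_rfl
  · simp [Finset.inter_subset_right]
  · rw [if_pos fun i hi j hj => hind i (Finset.mem_inter.mp hi).1 j (Finset.mem_inter.mp hj).1]
    refine (hp _).lt_of_ne (Ne.symm (Finset.prod_ne_zero_iff.mpr fun i hi => hne i ?_))
    simp only [Finset.mem_sdiff, Finset.mem_inter, not_and] at hi ⊢
    exact ⟨hst hi.1, fun hiI => hi.2 hiI hi.1⟩

end Counting

/-! ### Comparing principal minors with the recursion. -/

section Determinant

variable {V : Type*} [Fintype V] [DecidableEq V] (H : SimpleGraph V) [DecidableRel H.Adj]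
  (d : V → ℝ)

/-- The matrix `diag(d) + A(H)` on the rows and columns in `s`, the identity elsewhere. -/
def paddedMatrix (s : Finset V) : Matrix V V ℝ :=
  pin (diagonal d + H.adjMatrix ℝ) sᶜ

theorem paddedMatrix_apply (s : Finset V) (i j : V) :
    paddedMatrix H d s i j = if i = j then (if i ∈ s then d i else 1)
      else if i ∈ s ∧ j ∈ s ∧ H.Adj i j then 1 else 0 := by
  simp only [paddedMatrix, pin_apply, Finset.mem_compl, Matrix.add_apply, diagonal_apply,
    SimpleGraph.adjMatrix_apply, one_apply]
  by_cases h : i = j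
  · subst h; simp
  · simp only [h, if_false]; grind

theorem isHermitian_paddedMatrix (s : Finset V) : (paddedMatrix H d s).IsHermitian := by
  ext i j
  simp only [conjTranspose_apply, paddedMatrix_apply, star_trivial, H.adj_comm j i]
  grind

theorem pin_paddedMatrix_insert {v : V} {s : Finset V} (hv : v ∉ s) (a : ℝ) :
    pin (paddedMatrix H (Function.update d v a) (insert v s)) {v} = paddedMatrix H d s := by
  ext i j
  simp only [pin_apply, paddedMatrix_apply, one_apply, Finset.mem_singleton, Finset.mem_insert,
    Function.update_apply]
  grind

/-- The determinant is affine in the diagonal entry at `v`. Leaving exactly `1` there matches the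
first term of `indepSum_insert` and gives the pivot for the elimination. -/
theorem det_paddedMatrix_insert {v : V} {s : Finset V} (hv : v ∉ s) :
    (paddedMatrix H d (insert v s)).det = (d v - 1) * (paddedMatrix H d s).det +
      (paddedMatrix H (Function.update d v 1) (insert v s)).det := by
  rw [det_eq_sub_mul_det_pin_add (u := v)
    (Q := paddedMatrix H (Function.update d v 1) (insert v s))]
  · congr 2
    · simp [paddedMatrix_apply]
    · rw [← pin_paddedMatrix_insert H d hv (d v), Function.update_eq_self]
  · intro i j hij
    simp only [paddedMatrix_apply, Function.update_apply]
    grind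

variable {H d}

theorem posSemidef_paddedMatrix (hd : ∀ i, (H.degree i : ℝ) ≤ d i) (s : Finset V) :
    (paddedMatrix H d s).PosSemidef := by
  refine (isHermitian_paddedMatrix H d s).posSemidef_of_sum_abs_le_diag fun i => ?_
  by_cases hi : i ∈ s
  · have h1 : ∑ j ∈ Finset.univ.erase i, |paddedMatrix H d s i j| ≤
        ∑ j, if H.Adj i j then (1 : ℝ) else 0 := by
      refine (Finset.sum_le_sum fun j hj => ?_).trans
        (Finset.sum_le_sum_of_subset_of_nonneg (Finset.erase_subset i _) fun j _ _ => by
          split_ifs <;> norm_num)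
      rw [paddedMatrix_apply, if_neg (Finset.ne_of_mem_erase hj).symm]
      split_ifs with h h' h' <;> simp_all
    refine h1.trans ?_
    rw [paddedMatrix_apply, if_pos rfl, if_pos hi, Finset.sum_boole]
    refine le_trans (le_of_eq ?_) (hd i)
    rw [← SimpleGraph.card_neighborFinset_eq_degree, SimpleGraph.neighborFinset_eq_filter]
  · rw [Finset.sum_eq_zero fun j hj => ?_]
    · simp [paddedMatrix_apply, hi]
    · simp [paddedMatrix_apply, hi, (Finset.ne_of_mem_erase hj).symm]

variable (H d) in
/-- Elimination of a vertex `v` with diagonal entry `1`. -/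
theorem exists_eliminated {v : V} {s : Finset V} (hv : v ∉ s) :
    ∃ Q : Matrix V V ℝ,
      Q.det = (paddedMatrix H (Function.update d v 1) (insert v s)).det ∧
      pin Q {u ∈ s | H.Adj v u} = paddedMatrix H d {u ∈ s | ¬ H.Adj v u} ∧
      (∀ u ∈ s, H.Adj v u → Q u u = d u - 1) ∧
      (∀ u ∈ s, H.Adj v u → ∀ w, w ≠ u → Q u w =
        if w ∈ s then (if H.Adj u w then 1 else 0) - (if H.Adj v w then 1 else 0) else 0) ∧
      ((paddedMatrix H d s).PosSemidef → 0 < Q.det → Q.PosDef) := by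
  set M := paddedMatrix H (Function.update d v 1) (insert v s) with hM
  -- The pivot `M v v` is `1`, so subtracting row and column `v` from those of its neighbours in `s`
  -- clears the off-diagonal entries there.
  obtain ⟨Q, hQ, hdet, hpsd⟩ := exists_congruence_eq (P := M) (v := v)
    (c := fun i => if i ∈ s ∧ H.Adj v i then -1 else 0) (by simp [hv])
  have hpin : pin M {v} = paddedMatrix H d s := pin_paddedMatrix_insert H d hv 1
  have hMv : M v v = 1 := by simp [hM, paddedMatrix_apply]
  have hrow : ∀ j, j ≠ v → M v j = if j ∈ s ∧ H.Adj v j then 1 else 0 := fun j hj => by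
    simp [hM, paddedMatrix_apply, hj, hj.symm]
  have hcol : ∀ j, j ≠ v → M j v = if j ∈ s ∧ H.Adj v j then 1 else 0 := fun j hj => by
    simp [hM, paddedMatrix_apply, hj, H.adj_comm j v]
  have hin : ∀ i j, i ≠ v → j ≠ v → M i j = paddedMatrix H d s i j := fun i j hi hj => by
    simp [← hpin, pin_apply, hi, hj]
  refine ⟨Q, hdet, ?_, ?_, ?_, ?_⟩
  · ext i j
    by_cases hi : i = v <;> by_cases hj : j = v
    · subst hi; subst hj
      simp [pin_apply, hQ, hMv, paddedMatrix_apply, hv]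
    · subst hi
      simp only [pin_apply, hQ, hMv, hrow j hj, paddedMatrix_apply, one_apply,
        Finset.mem_filter, hv]
      grind
    · subst hj
      simp only [pin_apply, hQ, hMv, hcol i hi, paddedMatrix_apply, one_apply,
        Finset.mem_filter, hv]
      grind
    · simp only [pin_apply, hQ, hMv, hcol i hi, hrow j hj, hin i j hi hj, paddedMatrix_apply,
        one_apply, Finset.mem_filter]
      grind
  · intro u hu hvu
    have huv : u ≠ v := fun h => hv (h ▸ hu)
    rw [hQ, hMv, hcol u huv, hrow u huv, hin u u huv huv, paddedMatrix_apply]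
    simp only [hu, hvu, and_self, if_true]
    ring
  · intro u hu hvu w hw
    have huv : u ≠ v := fun h => hv (h ▸ hu)
    by_cases hwv : w = v
    · subst hwv
      simp [hQ, hMv, hcol u huv, hu, hvu, hv]
    · rw [hQ, hMv, hcol u huv, hrow w hwv, hin u w huv hwv, paddedMatrix_apply]
      simp only [hu, hvu, hw.symm, true_and, and_self, if_true, if_false]
      grind
  · intro hs hpos
    rw [hdet] at hpos
    have hMh : M.IsHermitian := isHermitian_paddedMatrix _ _ _
    -- With its entry at `v` lowered to `1`, `M` need not be positive semidefinite, but its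
    -- principal block off `v` is. A positive determinant of `M` forces that block to be
    -- nonsingular, and then `M` itself is positive definite.
    have hle := hMh.det_le_of_pin_posSemidef (u := v) (by rw [hpin]; exact hs)
    rw [hMv, one_mul, hpin] at hle
    have hpd : (pin M {v}).PosDef := by
      rw [hpin]
      exact hs.posDef_iff_det_ne_zero.mpr (hpos.trans_le hle).ne'
    have := hpsd (hMh.posDef_of_pin hpd hpos).posSemidef
    exact this.posDef_iff_det_ne_zero.mpr (by rw [hdet]; exact hpos.ne')

theorem det_update_one_le (hd : ∀ i, (H.degree i : ℝ) ≤ d i) (h1 : ∀ i, 1 ≤ d i)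
    {v : V} {s : Finset V} (hv : v ∉ s) :
    (paddedMatrix H (Function.update d v 1) (insert v s)).det ≤
      (∏ u ∈ s with H.Adj v u, (d u - 1)) * (paddedMatrix H d {u ∈ s | ¬ H.Adj v u}).det := by
  obtain ⟨Q, hdet, hpin, hdiag, -, hpd⟩ := exists_eliminated H d hv
  rw [← hdet]
  -- Fischer applies only when `Q` is positive definite; if its determinant is not positive, the
  -- bound is trivial because the right side is nonnegative.
  by_cases hpos : 0 < Q.det
  · have := (hpd (posSemidef_paddedMatrix hd s) hpos).det_le_prod_mul_det_pin {u ∈ s | H.Adj v u}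
    rwa [hpin, Finset.prod_congr rfl fun u hu => hdiag u (Finset.mem_filter.mp hu).1
      (Finset.mem_filter.mp hu).2] at this
  · exact (not_lt.mp hpos).trans (mul_nonneg
      (Finset.prod_nonneg fun i _ => sub_nonneg.mpr (h1 i)) (posSemidef_paddedMatrix hd _).det_nonneg)

theorem det_paddedMatrix_le_indepSum (hd : ∀ i, (H.degree i : ℝ) ≤ d i) (h1 : ∀ i, 1 ≤ d i)
    (s : Finset V) : (paddedMatrix H d s).det ≤ indepSum H d s := by
  induction s using Finset.strongInduction with
  | H s ih =>
    rcases s.eq_empty_or_nonempty with rfl | ⟨v, hv⟩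
    · have : paddedMatrix H d ∅ = 1 := by ext; simp [paddedMatrix_apply, one_apply]
      simp [this, indepSum]
    · obtain ⟨t, hvt, rfl⟩ : ∃ t, v ∉ t ∧ s = insert v t :=
        ⟨s.erase v, by simp, (Finset.insert_erase hv).symm⟩
      have hts : t ⊂ insert v t := Finset.ssubset_insert hvt
      rw [det_paddedMatrix_insert H d hvt, indepSum_insert H d hvt]
      refine add_le_add (mul_le_mul_of_nonneg_left (ih t hts) (sub_nonneg.mpr (h1 v)))
        ((det_update_one_le hd h1 hvt).trans (mul_le_mul_of_nonneg_left ?_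
          (Finset.prod_nonneg fun i _ => sub_nonneg.mpr (h1 i))))
      exact ih _ ((Finset.filter_subset _ _).trans_ssubset hts)

/-- The hypothesis on `a` and `b` says that eliminating `v` leaves a nonzero entry at `(a, b)`,
which makes Fischer strict. `hpos` settles the case where the eliminated matrix has no positive
determinant. -/
theorem det_paddedMatrix_lt_of_mem (hd : ∀ i, (H.degree i : ℝ) ≤ d i) (h1 : ∀ i, 1 ≤ d i)
    {s : Finset V} {v a b : V} (hv : v ∈ s) (ha : a ∈ s) (hb : b ∈ s) (hva : H.Adj v a)
    (hab : b ≠ a) (hbv : b ≠ v) (h : ¬ (H.Adj a b ↔ H.Adj v b))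
    (hpos : 0 < (∏ u ∈ s.erase v with H.Adj v u, (d u - 1)) *
      indepSum H d {u ∈ s.erase v | ¬ H.Adj v u}) :
    (paddedMatrix H d s).det < indepSum H d s := by
  obtain ⟨t, hvt, rfl⟩ : ∃ t, v ∉ t ∧ s = insert v t :=
    ⟨s.erase v, by simp, (Finset.insert_erase hv).symm⟩
  rw [Finset.erase_insert hvt] at hpos
  rw [det_paddedMatrix_insert H d hvt, indepSum_insert H d hvt]
  refine add_lt_add_of_le_of_lt (mul_le_mul_of_nonneg_left (det_paddedMatrix_le_indepSum hd h1 t)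
    (sub_nonneg.mpr (h1 v))) ?_
  obtain ⟨Q, hdet, hpin, hdiag, hoff, hpd⟩ := exists_eliminated H d hvt
  have hat : a ∈ t := Finset.mem_of_mem_insert_of_ne ha hva.ne'
  have hbt : b ∈ t := Finset.mem_of_mem_insert_of_ne hb hbv
  rw [← hdet]
  by_cases hQ : 0 < Q.det
  · have := (hpd (posSemidef_paddedMatrix hd t) hQ).det_lt_prod_mul_det_pin
      (T := {u ∈ t | H.Adj v u}) (u := a) (j := b) (by simp [hat, hva]) hab (by
        rw [hoff a hat hva b hab, if_pos hbt]
        split_ifs <;> simp_all)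
    rw [hpin, Finset.prod_congr rfl fun u hu => hdiag u (Finset.mem_filter.mp hu).1
      (Finset.mem_filter.mp hu).2] at this
    exact this.trans_le (mul_le_mul_of_nonneg_left (det_paddedMatrix_le_indepSum hd h1 _)
      (Finset.prod_nonneg fun i _ => sub_nonneg.mpr (h1 i)))
  · exact (not_lt.mp hQ).trans_lt hpos

theorem det_paddedMatrix_lt_indepSum (hd : ∀ i, (H.degree i : ℝ) ≤ d i) (h1 : ∀ i, 1 ≤ d i)
    {s : Finset V} (hpos : 0 < indepSum H d s) {u v w : V} (hu : u ∈ s) (hv : v ∈ s) (hw : w ∈ s)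
    (huv : H.Adj u v) (hvw : H.Adj v w) (hne : u ≠ w) (huw : ¬ H.Adj u w) :
    (paddedMatrix H d s).det < indepSum H d s := by
  -- Eliminating `v` works if its neighbours all have `d > 1`, since the second term of the
  -- recursion is then positive. Otherwise eliminate a neighbour `x` with `d x = 1`: the first term
  -- vanishes, so the second equals the whole positive sum.
  by_cases hx : ∃ x ∈ s, H.Adj v x ∧ d x = 1
  · obtain ⟨x, hxs, hvx, hdx⟩ := hx
    have hp := indepSum_insert H d (Finset.notMem_erase x s)
    rw [Finset.insert_erase hxs, hdx, sub_self, zero_mul, zero_add] at hp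
    rw [hp] at hpos
    by_cases hxu : x ≠ u ∧ ¬ H.Adj x u
    · exact det_paddedMatrix_lt_of_mem hd h1 hxs hv hu hvx.symm huv.ne hxu.1.symm
        (by simp [huv.symm, hxu.2]) hpos
    by_cases hxw : x ≠ w ∧ ¬ H.Adj x w
    · exact det_paddedMatrix_lt_of_mem hd h1 hxs hv hw hvx.symm hvw.ne' hxw.1.symm
        (by simp [hvw, hxw.2]) hpos
    -- Here `x` equals or is adjacent to each of `u` and `w`; equality with one would make `u` and
    -- `w` adjacent.
    have h2 : H.Adj x u ∧ H.Adj x w := by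
      have := H.adj_comm u w
      by_cases e1 : x = u
      · subst e1; tauto
      · by_cases e2 : x = w
        · subst e2; tauto
        · tauto
    exact det_paddedMatrix_lt_of_mem hd h1 hxs hu hw h2.1 hne.symm h2.2.ne'
      (by simp [huw, h2.2]) hpos
  · push Not at hx
    refine det_paddedMatrix_lt_of_mem hd h1 hv hu hw huv.symm hne.symm hvw.ne'
      (by simp [huw, hvw]) (mul_pos (Finset.prod_pos fun i hi => ?_)
        (indepSum_pos_of_subset h1 ((Finset.filter_subset _ _).trans (Finset.erase_subset _ _))
          hpos))
    obtain ⟨hi1, hi2⟩ := Finset.mem_filter.mp hi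
    exact sub_pos.mpr ((h1 i).lt_of_ne (hx i (Finset.mem_of_mem_erase hi1) hi2).symm)

/-- Adjacent vertices have the same other neighbours, so after eliminating `v` the rows of its
neighbours are diagonal and the determinant factors exactly. -/
theorem det_paddedMatrix_eq_indepSum
    (h : ∀ u v w, H.Adj u v → H.Adj v w → u ≠ w → H.Adj u w) (s : Finset V) :
    (paddedMatrix H d s).det = indepSum H d s := by
  induction s using Finset.strongInduction with
  | H s ih =>
    rcases s.eq_empty_or_nonempty with rfl | ⟨v, hv⟩
    · have : paddedMatrix H d ∅ = 1 := by ext; simp [paddedMatrix_apply, one_apply]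
      simp [this, indepSum]
    · obtain ⟨t, hvt, rfl⟩ : ∃ t, v ∉ t ∧ s = insert v t :=
        ⟨s.erase v, by simp, (Finset.insert_erase hv).symm⟩
      have hts : t ⊂ insert v t := Finset.ssubset_insert hvt
      obtain ⟨Q, hdet, hpin, hdiag, hoff, -⟩ := exists_eliminated H d hvt
      rw [det_paddedMatrix_insert H d hvt, indepSum_insert H d hvt, ih t hts,
        ← ih _ ((Finset.filter_subset (fun u => ¬ H.Adj v u) t).trans_ssubset hts), ← hdet, ← hpin,
        det_eq_prod_mul_det_pin (P := Q) (T := {u ∈ t | H.Adj v u})]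
      · congr 2
        exact Finset.prod_congr rfl fun u hu => hdiag u (Finset.mem_filter.mp hu).1
          (Finset.mem_filter.mp hu).2
      · intro u hu w hwu
        obtain ⟨hu, hvu⟩ := Finset.mem_filter.mp hu
        rw [hoff u hu hvu w hwu]
        split_ifs with hw h2 h3 h3
        · simp
        · exact absurd (h v u w hvu h2 fun e => hvt (e ▸ hw)) h3
        · exact absurd (h u v w hvu.symm h3 hwu.symm) h2
        · simp
        · rfl

end Determinant

end RootedGraph

/-! ### Standard monomials of the skeleton ideal. -/

namespace RootedGraph

open MvPolynomial

/-- The standard monomials form a basis of the quotient by a monomial ideal. -/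
theorem finrank_quotient_span_monomial {K σ : Type*} [Field K] {E : Set (σ →₀ ℕ)}
    {T : Finset (σ →₀ ℕ)} (hT : ∀ a, a ∈ T ↔ ∀ e ∈ E, ¬ e ≤ a) :
    Module.finrank K (MvPolynomial σ K ⧸
      Ideal.span ((fun e => monomial e (1 : K)) '' E)) = T.card := by
  set I := Ideal.span ((fun e => monomial e (1 : K)) '' E)
  let φ : MvPolynomial σ K →ₗ[K] (T → K) := LinearMap.pi fun a => lcoeff K a.1
  have hφ : ∀ p a, φ p a = coeff a.1 p := fun p a => rfl
  have hker : LinearMap.ker φ = I.restrictScalars K := by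
    ext p
    rw [LinearMap.mem_ker, Submodule.restrictScalars_mem, mem_ideal_span_monomial_image]
    constructor
    · intro h a ha
      by_contra! hc
      have := congrFun h ⟨a, (hT a).mpr hc⟩
      rw [hφ] at this
      exact mem_support_iff.mp ha this
    · intro h
      ext ⟨a, ha⟩
      rw [hφ]
      by_contra hne
      obtain ⟨e, he, hle⟩ := h a (mem_support_iff.mpr hne)
      exact (hT a).mp ha e he hle
  have hsurj : Function.Surjective φ := by
    classical
    intro f
    refine ⟨∑ a : T, monomial a.1 (f a), ?_⟩
    ext b
    rw [hφ, coeff_sum, Finset.sum_eq_single b]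
    · simp
    · intro a _ hab
      rw [coeff_monomial, if_neg fun h => hab (Subtype.ext h)]
    · simp
  have e1 := (Submodule.Quotient.restrictScalarsEquiv K I).symm.trans
    ((Submodule.quotEquivOfEq _ _ hker.symm).trans (φ.quotKerEquivOfSurjective hsurj))
  rw [e1.finrank_eq, Module.finrank_fintype_fun_eq_card, Fintype.card_coe]

section

variable {V : Type*} [Fintype V] [DecidableEq V] (G : SimpleGraph V) [DecidableRel G.Adj] {r : V}

theorem outDegree_singleton (i : {v : V // v ≠ r}) : outDegree G {i} i = G.degree i.1 := by
  rw [outDegree, Finset.sdiff_eq_self_of_disjoint, SimpleGraph.card_neighborFinset_eq_degree]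
  simp

theorem outDegree_pair_left (i j : {v : V // v ≠ r}) :
    outDegree G {i, j} i = G.degree i.1 - if G.Adj i.1 j.1 then 1 else 0 := by
  have : G.neighborFinset i.1 \ Finset.map (Function.Embedding.subtype _) {i, j} =
      (G.neighborFinset i.1).erase j.1 := by
    ext w
    simp only [Finset.map_insert, Finset.map_singleton, Function.Embedding.subtype_apply,
      Finset.mem_sdiff, Finset.mem_insert, Finset.mem_singleton, Finset.mem_erase,
      SimpleGraph.mem_neighborFinset]
    constructor
    · tauto
    · rintro ⟨h1, h2⟩
      exact ⟨h2, by rintro (rfl | h); exacts [G.loopless.irrefl _ h2, h1 h]⟩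
  rw [outDegree, this]
  split_ifs with h
  · rw [Finset.card_erase_of_mem (by simpa using h), SimpleGraph.card_neighborFinset_eq_degree]
  · rw [Finset.erase_eq_of_notMem (by simpa using h), SimpleGraph.card_neighborFinset_eq_degree,
      Nat.sub_zero]

theorem skeletonMonomial_eq_monomial (K : Type*) [Field K] (S : Finset {v : V // v ≠ r}) :
    skeletonMonomial K G S =
      monomial (∑ i ∈ S, Finsupp.single i (outDegree G S i)) 1 := by
  rw [skeletonMonomial, monomial_sum_one]
  exact Finset.prod_congr rfl fun i _ => by rw [X_pow_eq_monomial]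

theorem sum_single_le_iff {σ : Type*} [DecidableEq σ] (S : Finset σ) (f : σ → ℕ) (a : σ →₀ ℕ) :
    ∑ i ∈ S, Finsupp.single i (f i) ≤ a ↔ ∀ i ∈ S, f i ≤ a i := by
  have h : ∀ j, (∑ i ∈ S, Finsupp.single i (f i)) j = if j ∈ S then f j else 0 := by
    intro j
    simp [Finsupp.finsetSum_apply, Finsupp.single_apply]
  rw [Finsupp.le_def]
  refine forall_congr' fun j => ?_
  rw [h]
  split_ifs with hj <;> simp [hj]

/-- The exponents of the standard monomials of the `1`-skeleton ideal. -/
theorem forall_not_le_iff (a : {v : V // v ≠ r} → ℕ) :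
    (∀ S : Finset {v : V // v ≠ r}, S.Nonempty → S.card ≤ 2 →
      ¬ ∀ i ∈ S, outDegree G S i ≤ a i) ↔
    (∀ i, a i < G.degree i.1) ∧ ∀ i j, (deleteRoot G r).Adj i j →
      ¬ (a i = G.degree i.1 - 1 ∧ a j = G.degree j.1 - 1) := by
  constructor
  · refine fun h => ⟨fun i => ?_, fun i j hij ⟨hi, hj⟩ => ?_⟩
    · have := h {i} (by simp) (by simp)
      simpa [outDegree_singleton] using this
    · have hG : G.Adj i.1 j.1 := hij
      refine h {i, j} (by simp) Finset.card_le_two fun k hk => ?_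
      rcases Finset.mem_insert.mp hk with e | hk
      · rw [e, outDegree_pair_left, if_pos hG, hi]
      · rw [Finset.mem_singleton.mp hk, Finset.pair_comm, outDegree_pair_left, if_pos hG.symm, hj]
  · rintro ⟨h1, h2⟩ S hS hcard hle
    have hpos := hS.card_pos
    obtain hc | hc : S.card = 1 ∨ S.card = 2 := by omega
    · obtain ⟨i, rfl⟩ := Finset.card_eq_one.mp hc
      have := hle i (by simp)
      rw [outDegree_singleton] at this
      have := h1 i
      omega
    · obtain ⟨i, j, hij, rfl⟩ := Finset.card_eq_two.mp hc
      have hi := hle i (by simp)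
      have hj := hle j (by simp)
      rw [outDegree_pair_left] at hi
      rw [Finset.pair_comm, outDegree_pair_left] at hj
      have h1i := h1 i
      have h1j := h1 j
      by_cases hG : G.Adj i.1 j.1
      · rw [if_pos hG] at hi
        rw [if_pos hG.symm] at hj
        exact h2 i j hG ⟨by omega, by omega⟩
      · rw [if_neg hG] at hi
        omega

end

/-- The functions below `D` whose set of maximal entries is independent. -/
theorem exists_finset_card_eq_indepSum {V : Type*} [Fintype V] [DecidableEq V] (H : SimpleGraph V)
    [DecidableRel H.Adj] (D : V → ℕ) (hD : ∀ i, 1 ≤ D i) :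
    ∃ T : Finset (V → ℕ), (T.card : ℝ) = indepSum H (fun i => (D i : ℝ)) Finset.univ ∧
      ∀ a, a ∈ T ↔ (∀ i, a i < D i) ∧ ∀ i j, H.Adj i j → ¬ (a i = D i - 1 ∧ a j = D j - 1) := by
  -- `box I` collects the functions whose set of maximal entries is exactly `I`. Off `I` there are
  -- `D i - 1` choices, which is the weight in `indepSum`; `1 ≤ D i` makes the truncated subtraction
  -- harmless.
  let box : Finset V → Finset (V → ℕ) := fun I =>
    Fintype.piFinset fun i => if i ∈ I then {D i - 1} else Finset.range (D i - 1)
  have hbox : ∀ I a, a ∈ box I ↔ ∀ i, if i ∈ I then a i = D i - 1 else a i < D i - 1 := by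
    intro I a
    rw [Fintype.mem_piFinset]
    refine forall_congr' fun i => ?_
    split_ifs <;> simp
  refine ⟨({I | ∀ i ∈ I, ∀ j ∈ I, ¬ H.Adj i j} : Finset (Finset V)).biUnion box, ?_, ?_⟩
  · rw [Finset.card_biUnion, indepSum, Finset.powerset_univ, Nat.cast_sum]
    · rw [Finset.sum_filter]
      refine Finset.sum_congr rfl fun I _ => ?_
      split_ifs
      swap
      · rfl
      rw [Fintype.card_piFinset, Nat.cast_prod,
        ← Finset.prod_sdiff (Finset.subset_univ I), Finset.prod_eq_one (s := I), mul_one]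
      · refine Finset.prod_congr rfl fun i hi => ?_
        rw [if_neg (Finset.mem_sdiff.mp hi).2, Finset.card_range, Nat.cast_sub (hD i), Nat.cast_one]
      · intro i hi
        simp [hi]
    · intro I _ J _ hIJ
      refine Finset.disjoint_left.mpr fun a ha hb => ?_
      rw [hbox] at ha hb
      refine hIJ (Finset.ext fun i => ?_)
      have h1 := ha i
      have h2 := hb i
      split_ifs at h1 h2 <;> first | tauto | omega
  · intro a
    simp only [Finset.mem_biUnion, Finset.mem_filter, Finset.mem_univ, true_and, hbox]
    constructor
    · rintro ⟨I, hI, ha⟩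
      have key : ∀ i, a i = D i - 1 → i ∈ I := fun i hi => by
        by_contra hc
        have := ha i
        rw [if_neg hc] at this
        omega
      refine ⟨fun i => ?_, fun i j hij h => hI i (key i h.1) j (key j h.2) hij⟩
      have h1 := ha i
      have h2 := hD i
      split_ifs at h1 <;> omega
    · rintro ⟨h1, h2⟩
      refine ⟨Finset.univ.filter fun i => a i = D i - 1, fun i hi j hj hij => h2 i j hij
        ⟨(Finset.mem_filter.mp hi).2, (Finset.mem_filter.mp hj).2⟩, fun i => ?_⟩
      have := h1 i
      simp only [Finset.mem_filter, Finset.mem_univ, true_and]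
      split_ifs <;> omega

variable (K : Type*) [Field K] {V : Type*} [Fintype V] [DecidableEq V] (G : SimpleGraph V)
  [DecidableRel G.Adj] (r : V)

theorem finrank_quotient_skeletonIdeal_one (hdeg : ∀ i : {v : V // v ≠ r}, 1 ≤ G.degree i.1) :
    (Module.finrank K (MvPolynomial {v : V // v ≠ r} K ⧸ skeletonIdeal K G r 1) : ℝ) =
      indepSum (deleteRoot G r) (fun i => (G.degree i.1 : ℝ)) Finset.univ := by
  obtain ⟨T, hcard, hT⟩ := exists_finset_card_eq_indepSum (deleteRoot G r)
    (fun i => G.degree i.1) hdeg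
  have hI : skeletonIdeal K G r 1 = Ideal.span ((fun e => monomial e (1 : K)) ''
      {e | ∃ S : Finset {v : V // v ≠ r}, S.Nonempty ∧ S.card ≤ 2 ∧
        e = ∑ i ∈ S, Finsupp.single i (outDegree G S i)}) := by
    rw [skeletonIdeal]
    congr 1
    ext m
    constructor
    · rintro ⟨S, h1, h2, rfl⟩
      exact ⟨_, ⟨S, h1, h2, rfl⟩, (skeletonMonomial_eq_monomial G K S).symm⟩
    · rintro ⟨_, ⟨S, h1, h2, rfl⟩, rfl⟩
      exact ⟨S, h1, h2, (skeletonMonomial_eq_monomial G K S).symm⟩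
  rw [hI, finrank_quotient_span_monomial
    (T := T.map Finsupp.equivFunOnFinite.symm.toEmbedding), Finset.card_map, hcard]
  intro a
  rw [Finset.mem_map_equiv, Equiv.symm_symm, hT, ← forall_not_le_iff G]
  constructor
  · rintro h _ ⟨S, h1, h2, rfl⟩
    rw [sum_single_le_iff]
    exact h S h1 h2
  · intro h S h1 h2 h3
    exact h _ ⟨S, h1, h2, rfl⟩ ((sum_single_le_iff _ _ _).mpr h3)

theorem skeletonIdeal_eq_top {i : {v : V // v ≠ r}} (h : G.degree i.1 = 0) (k : ℕ) :
    skeletonIdeal K G r k = ⊤ := by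
  rw [Ideal.eq_top_iff_one]
  exact Ideal.subset_span ⟨{i}, by simp, by simp, by
    simp [skeletonMonomial, outDegree_singleton, h]⟩

end RootedGraph

/-! ### Essentially connected components, the matrix entries and the conclusion. -/

namespace RootedGraph

section

variable {V : Type*} {G : SimpleGraph V} {r : V}

theorem isCompleteMinusRootEdges_iff :
    IsCompleteMinusRootEdges G r ↔ ∀ x y, x ≠ r → y ≠ r → x ≠ y → G.Adj x y := by
  constructor
  · rintro ⟨E, hE, rfl⟩ x y hx hy hxy
    rw [SimpleGraph.deleteEdges_adj]
    refine ⟨hxy, fun h => ?_⟩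
    have := (hE h).2
    rw [Sym2.mem_iff] at this
    rcases this with h | h
    · exact hx h.symm
    · exact hy h.symm
  · intro h
    refine ⟨(⊤ : SimpleGraph V).incidenceSet r \ G.edgeSet, Set.sdiff_subset, ?_⟩
    ext x y
    simp only [SimpleGraph.deleteEdges_adj, SimpleGraph.top_adj, Set.mem_sdiff,
      SimpleGraph.mk'_mem_incidenceSet_iff, SimpleGraph.mem_edgeSet, not_and, not_not]
    refine ⟨fun hxy => ⟨hxy.ne, fun _ => hxy⟩, fun ⟨hxy, h'⟩ => ?_⟩
    by_cases hr : r = x ∨ r = y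
    · exact h' ⟨hxy, hr⟩
    · push Not at hr
      exact h x y hr.1.symm hr.2.symm hxy

theorem adj_of_reachable {H : SimpleGraph V}
    (h : ∀ u v w, H.Adj u v → H.Adj v w → u ≠ w → H.Adj u w) {u w : V} (hr : H.Reachable u w)
    (hne : u ≠ w) : H.Adj u w := by
  obtain ⟨p⟩ := hr
  induction p with
  | nil => exact absurd rfl hne
  | @cons u v w huv p ih =>
    by_cases hvw : v = w
    · exact hvw ▸ huv
    · exact h u v w huv (ih hvw) hne

/-- Both sides say that the graph without the root is a disjoint union of cliques; the local form on
three vertices is what the determinant argument uses. -/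
theorem forall_essComponent_iff :
    (∀ c : (deleteRoot G r).ConnectedComponent,
      IsCompleteMinusRootEdges (essComponent G r c) (essRoot G r c)) ↔
    ∀ u v w, (deleteRoot G r).Adj u v → (deleteRoot G r).Adj v w → u ≠ w →
      (deleteRoot G r).Adj u w := by
  simp only [isCompleteMinusRootEdges_iff]
  constructor
  · intro h u v w huv hvw huw
    set c := (deleteRoot G r).connectedComponentMk u
    have hu : u.1 ∈ essVertices G r c :=
      Set.mem_insert_of_mem _ ⟨u, rfl, rfl⟩
    have hw : w.1 ∈ essVertices G r c :=
      Set.mem_insert_of_mem _ ⟨w, SimpleGraph.ConnectedComponent.sound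
        (huv.reachable.trans hvw.reachable).symm, rfl⟩
    exact h c ⟨u.1, hu⟩ ⟨w.1, hw⟩ (fun e => u.2 (congrArg Subtype.val e))
      (fun e => w.2 (congrArg Subtype.val e))
      (fun e => huw (Subtype.ext (Subtype.mk.inj e)))
  · rintro h c ⟨x, hx⟩ ⟨y, hy⟩ hxr hyr hxy
    rcases hx with rfl | ⟨u, hu, rfl⟩
    · exact absurd rfl hxr
    rcases hy with rfl | ⟨w, hw, rfl⟩
    · exact absurd rfl hyr
    exact adj_of_reachable h (SimpleGraph.ConnectedComponent.exact (hu.trans hw.symm))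
      (fun e => hxy (by subst e; rfl))

end

variable {V : Type*} [Fintype V] [DecidableEq V] (G : SimpleGraph V) [DecidableRel G.Adj] (r : V)

theorem cast_det_truncSignlessLapMatrix :
    ((truncSignlessLapMatrix G r).det : ℝ) =
      (paddedMatrix (deleteRoot G r) (fun i => (G.degree i.1 : ℝ)) Finset.univ).det := by
  rw [Int.cast_det]
  congr 1
  ext i j
  simp only [truncSignlessLapMatrix, signlessLapMatrix, SimpleGraph.degMatrix, Matrix.map_apply,
    Matrix.submatrix_apply, Matrix.add_apply, Matrix.diagonal_apply, SimpleGraph.adjMatrix_apply,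
    paddedMatrix_apply, Finset.mem_univ, if_true, true_and, SimpleGraph.comap_adj,
    Function.Embedding.subtype_apply]
  by_cases h : i = j
  · subst h; simp
  · have h' : i.1 ≠ j.1 := fun e => h (Subtype.ext e)
    simp [h, h']

theorem det_truncSignlessLapMatrix_eq_zero {i : {v : V // v ≠ r}} (h : G.degree i.1 = 0) :
    (truncSignlessLapMatrix G r).det = 0 := by
  refine Matrix.det_eq_zero_of_row_eq_zero i fun j => ?_
  have hadj : ¬ G.Adj i.1 j.1 := fun hadj =>
    ((G.degree_pos_iff_exists_adj i.1).mpr ⟨_, hadj⟩).ne' h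
  simp [truncSignlessLapMatrix, signlessLapMatrix, SimpleGraph.degMatrix, Matrix.diagonal_apply,
    hadj, h]

theorem degree_deleteRoot_le (i : {v : V // v ≠ r}) :
    (deleteRoot G r).degree i ≤ G.degree i.1 := by
  rw [← SimpleGraph.card_neighborFinset_eq_degree, ← SimpleGraph.card_neighborFinset_eq_degree]
  refine Finset.card_le_card_of_injOn Subtype.val (fun j hj => ?_) Subtype.val_injective.injOn
  simpa using hj

end RootedGraph

theorem mainTheorem6 (K : Type*) [Field K] (n : ℕ) (G : SimpleGraph (Fin (n + 1)))
    [DecidableRel G.Adj] :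
    (RootedGraph.skeletonIdeal K G 0 1 ≠ ⊤ →
      ((Module.finrank K
          (MvPolynomial {v : Fin (n + 1) // v ≠ 0} K ⧸ RootedGraph.skeletonIdeal K G 0 1) : ℤ) =
          (RootedGraph.truncSignlessLapMatrix G 0).det ↔
        ∀ c : (RootedGraph.deleteRoot G 0).ConnectedComponent,
          RootedGraph.IsCompleteMinusRootEdges
            (RootedGraph.essComponent G 0 c) (RootedGraph.essRoot G 0 c))) ∧
    ((∀ c : (RootedGraph.deleteRoot G 0).ConnectedComponent,
        RootedGraph.IsCompleteMinusRootEdges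
          (RootedGraph.essComponent G 0 c) (RootedGraph.essRoot G 0 c)) →
      (Module.finrank K
          (MvPolynomial {v : Fin (n + 1) // v ≠ 0} K ⧸ RootedGraph.skeletonIdeal K G 0 1) : ℤ) =
          (RootedGraph.truncSignlessLapMatrix G 0).det) := by
  rw [RootedGraph.forall_essComponent_iff]
  have hif : (∀ u v w, (RootedGraph.deleteRoot G 0).Adj u v →
      (RootedGraph.deleteRoot G 0).Adj v w → u ≠ w → (RootedGraph.deleteRoot G 0).Adj u w) →
      (Module.finrank K
          (MvPolynomial {v : Fin (n + 1) // v ≠ 0} K ⧸ RootedGraph.skeletonIdeal K G 0 1) : ℤ) =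
          (RootedGraph.truncSignlessLapMatrix G 0).det := by
    intro h
    by_cases hdeg : ∀ i : {v : Fin (n + 1) // v ≠ 0}, 1 ≤ G.degree i.1
    · have := RootedGraph.finrank_quotient_skeletonIdeal_one K G 0 hdeg
      rw [← RootedGraph.det_paddedMatrix_eq_indepSum h,
        ← RootedGraph.cast_det_truncSignlessLapMatrix] at this
      exact_mod_cast this
    · push Not at hdeg
      obtain ⟨i, hi⟩ := hdeg
      have hi0 : G.degree i.1 = 0 := by omega
      rw [RootedGraph.det_truncSignlessLapMatrix_eq_zero G 0 hi0,
        RootedGraph.skeletonIdeal_eq_top K G 0 hi0]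
      have : Subsingleton (MvPolynomial {v : Fin (n + 1) // v ≠ 0} K ⧸
          (⊤ : Ideal (MvPolynomial {v : Fin (n + 1) // v ≠ 0} K))) :=
        Ideal.Quotient.subsingleton_iff.mpr rfl
      rw [Module.finrank_zero_of_subsingleton, Nat.cast_zero]
  refine ⟨fun htop => ⟨fun heq u v w huv hvw hne => ?_, hif⟩, hif⟩
  have hdeg : ∀ i : {v : Fin (n + 1) // v ≠ 0}, 1 ≤ G.degree i.1 := fun i => by
    by_contra hc
    exact htop (RootedGraph.skeletonIdeal_eq_top K G 0 (i := i) (by omega) 1)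
  have hfin := RootedGraph.finrank_quotient_skeletonIdeal_one K G 0 hdeg
  -- A proper ideal has nonzero quotient. This positivity is what the strict inequality needs, and
  -- the only place besides `hdeg` where properness enters.
  have hpos : 0 < Module.finrank K
      (MvPolynomial {v : Fin (n + 1) // v ≠ 0} K ⧸ RootedGraph.skeletonIdeal K G 0 1) := by
    have := RootedGraph.finite_quotient_skeletonIdeal K G 0 1
    have : Nontrivial (MvPolynomial {v : Fin (n + 1) // v ≠ 0} K ⧸
        RootedGraph.skeletonIdeal K G 0 1) := Ideal.Quotient.nontrivial_iff.mpr htop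
    exact Module.finrank_pos
  by_contra huw
  have hlt := RootedGraph.det_paddedMatrix_lt_indepSum (H := RootedGraph.deleteRoot G 0)
    (d := fun i => (G.degree i.1 : ℝ)) (s := Finset.univ)
    (fun i => by exact_mod_cast RootedGraph.degree_deleteRoot_le G 0 i)
    (fun i => by exact_mod_cast hdeg i) (by rw [← hfin]; exact_mod_cast hpos)
    (Finset.mem_univ u) (Finset.mem_univ v) (Finset.mem_univ w) huv hvw hne huw
  rw [← RootedGraph.cast_det_truncSignlessLapMatrix, ← hfin, ← heq] at hlt
  simp at hlt
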